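/- Let $L$ be a biinfinite Toeplitz matrix with entries $L_{kl}=a_{k-l}$ $(k,l\in\mathbb Z)$ which defines a bounded, boundedly invertible, hermitian positive definite operator on $\ell^2(\mathbb Z)$. Let $\gamma>0$ and assume $L\in\mathcal E_\gamma$, i.e. $|L_{kl}|<C e^{-\gamma|k-l|}$ for all $k,l$ with some constant $C>0$. Let $x,y\in\ell^2(\mathbb Z)$ satisfy $Lx=y$, where $|y_k|\le c' e^{-\gamma|k|}$ for all $k\in\mathbb Z$ with some constant $c'$. For $n\ge 1$ let $A_n=[a_{k-l}]_{k,l=0}^{n-1}$, let $b_0\in\{a_n,0\}$, and let $B_n$ be the $n\times n$ Toeplitz matrix with first row $(b_0,a_{n-1},\dots,a_1)$ and first column $(b_0,a_{-(n-1)},\dots,a_{-1})^{T}$. Consider the embedding $$C_{2n}=\begin{bmatrix}A_n&B_n^*\\ B_n&A_n\end{bmatrix}$$ (which is circulant if $b_0$ is real) and the Schur complement $S_n=A_n-B_nA_n^{-1}B_n^*$. Let $y^{(n)}=(y_{k-\lfloor n/2\rfloor})_{k=0}^{n-1}$ be the vector of the $n$ central entries of $y$. A vector $z\in\mathbb C^n$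 is regarded as an element of $\ell^2(\mathbb Z)$ by placing $z_k$ at position $k-\lfloor n/2\rfloor$ and setting all other entries equal to $0$. Then there exist $\gamma_1$ with $0<\gamma_1<\gamma$, a constant $c$ independent of $n$, and an $N$ such that for all $n>N$ and both choices of $b_0$ the matrices $A_n$, $C_{2n}$ and $S_n$ are invertible, and the solution $z^{(n)}$ of $S_nz^{(n)}=y^{(n)}$ satisfies $$\|x-z^{(n)}\|\le c\,e^{-\gamma_1 n},$$ where $\|\cdot\|$ is the norm of $\ell^2(\mathbb Z)$. -/

import Mathlib

noncomputable section

namespace CircEmbed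

/-- The Hilbert space `ℓ²(ℤ)` of square-summable biinfinite complex sequences. -/
abbrev EllTwo : Type := lp (fun _ : ℤ => ℂ) 2

/-- The entries `A_{kl}` of the biinfinite matrix of a bounded operator on `ℓ²(ℤ)`:
the `k`-th coordinate of the image of the `l`-th standard unit vector. -/
def entry (A : EllTwo →L[ℂ] EllTwo) (k l : ℤ) : ℂ :=
  (A (lp.single 2 l (1 : ℂ))) k

/-- `A` is the biinfinite Toeplitz matrix (Laurent operator) with entries `A_{kl} = a_{k-l}`. -/
def IsToeplitz (A : EllTwo →L[ℂ] EllTwo) (a : ℤ → ℂ) : Prop :=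
  ∀ k l : ℤ, entry A k l = a (k - l)

/-- Hermitian positive definite operators on `ℓ²(ℤ)`: self-adjoint with nonnegative quadratic
form and boundedly invertible.  For a Laurent operator with continuous defining function `f`
this says that `f > 0` everywhere. -/
def IsHPD (A : EllTwo →L[ℂ] EllTwo) : Prop :=
  A.IsPositive ∧ IsUnit A

/-- The class `E_γ` of biinfinite matrices with exponential off-diagonal decay,
`|A_{kl}| < c e^{-γ |k-l|}` for some constant `c > 0`. -/
def ExpDecayClass (γ : ℝ) : Set (ℤ → ℤ → ℂ) :=
  {M | ∃ c : ℝ, 0 < c ∧ ∀ k l : ℤ, ‖M k l‖ < c * Real.exp (-γ * |(k : ℝ) - (l : ℝ)|)}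

/-- The `n × n` Toeplitz matrix `A_n` with entries `a_{k-l}`. -/
def toeplitzSection (a : ℤ → ℂ) (n : ℕ) : Matrix (Fin n) (Fin n) ℂ :=
  Matrix.of fun k l => a ((k : ℤ) - (l : ℤ))

/-- The `n × n` Toeplitz matrix `B_n` used in the circulant embedding of `A_n`: its first row is
`(b₀, a_{n-1}, …, a_1)` and its first column is `(b₀, a_{-(n-1)}, …, a_{-1})`. -/
def embeddingBlock (a : ℤ → ℂ) (n : ℕ) (b₀ : ℂ) : Matrix (Fin n) (Fin n) ℂ :=
  Matrix.of fun k l =>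
    if k < l then a ((n : ℤ) + (k : ℤ) - (l : ℤ))
    else if l < k then a ((k : ℤ) - (l : ℤ) - (n : ℤ))
    else b₀

/-- The `2n × 2n` embedding `C_{2n} = [[A_n, B_n^*], [B_n, A_n]]` of `A_n`.
For a hermitian sequence `a` and real `b₀` one has `B_n^* = B_n` and this matrix is circulant. -/
def circulantEmbedding (a : ℤ → ℂ) (n : ℕ) (b₀ : ℂ) :
    Matrix (Fin n ⊕ Fin n) (Fin n ⊕ Fin n) ℂ :=
  Matrix.fromBlocks (toeplitzSection a n) (embeddingBlock a n b₀).conjTranspose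
    (embeddingBlock a n b₀) (toeplitzSection a n)

/-- The Schur complement `S_n = A_n - B_n A_n⁻¹ B_n^*` in the embedding. -/
def schurMatrix (a : ℤ → ℂ) (n : ℕ) (b₀ : ℂ) : Matrix (Fin n) (Fin n) ℂ :=
  toeplitzSection a n -
    embeddingBlock a n b₀ * (toeplitzSection a n)⁻¹ * (embeddingBlock a n b₀).conjTranspose

/-- The integer position of the index `k ∈ {0, …, n-1}` in the window of `n` consecutive integers
centred at the origin, `{-⌊n/2⌋, …, n-1-⌊n/2⌋}`. -/
def windowPos (n : ℕ) (k : Fin n) : ℤ :=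
  (k : ℤ) - ((n / 2 : ℕ) : ℤ)

/-- The finite section `y^{(n)}`: the `n` central entries of `y`. -/
def windowRestrict (n : ℕ) (y : EllTwo) : Fin n → ℂ :=
  fun k => y (windowPos n k)

/-- A vector of length `n`, placed on the central window and extended by zero. -/
def windowExtend (n : ℕ) (z : Fin n → ℂ) : EllTwo :=
  ∑ k : Fin n, lp.single 2 (windowPos n k) (z k)

end CircEmbed

end

noncomputable section

namespace CircEmbed

open Matrix

/-! Everything rests on one coercivity constant `δ` of `L`, which passes to every section `A_n`.
Averaging the form of `A_n` over all cyclic shifts of a window shows that the circulant matrix with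
`b₀ = 0` keeps it up to `O(1/n)` (`isCoercive_circulant`). A general `b₀` costs only `‖b₀‖`, so
`C_{2n}` is eventually coercive with constant `δ / 2`. This gives invertibility of `C_{2n}`, hence
of the Schur complement, and a stability bound uniform in `n`.

The solution `x` decays exponentially by a weighted energy argument
(`exists_exp_decay_of_apply_eq`). Let `u` be its central section. By
`circulantEmbedding_mulVec_elim`, `C_{2n}` sends `(-A_n⁻¹ B_n^* z, z - u)` to `(-B_n^* u, y^{(n)} -
A_n u)`. The first block is small because the large entries of `B_n` sit in the corners and `u` is
small near the window's ends; the second is `L` applied to the tail of `x`. Stability then bounds `z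
- u`, with no separate lower bound for `S_n`. -/

/-! ### Coercivity and coordinates of the Laurent operator -/

/-- The square root `T` of `A` is invertible and self-adjoint, so the form equals `‖T x‖ ^ 2`, which
the inverse of `T` bounds below. -/
theorem exists_coercive_of_isPositive_of_isUnit {H : Type*} [NormedAddCommGroup H]
    [InnerProductSpace ℂ H] [CompleteSpace H] {A : H →L[ℂ] H} (hpos : A.IsPositive)
    (hu : IsUnit A) :
    ∃ δ : ℝ, 0 < δ ∧ ∀ x : H, δ * ‖x‖ ^ 2 ≤ RCLike.re (inner ℂ x (A x)) := by
  have hnn : 0 ≤ A := (ContinuousLinearMap.nonneg_iff_isPositive A).2 hpos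
  set T := CFC.sqrt A with hT
  have hTu : IsUnit T := (CFC.isUnit_sqrt_iff A hnn).2 hu
  have hTT : T * T = A := CFC.sqrt_mul_sqrt_self A hnn
  have hTsa : IsSelfAdjoint T := (CFC.sqrt_nonneg A).isSelfAdjoint
  obtain ⟨U, hU⟩ := hTu
  have key : ∀ x, ‖x‖ ≤ (‖(↑U⁻¹ : H →L[ℂ] H)‖ + 1) * ‖T x‖ := by
    intro x
    have h1 : (↑U⁻¹ : H →L[ℂ] H) (T x) = x := by
      have : ((↑U⁻¹ : H →L[ℂ] H) * T) x = x := by rw [← hU]; simp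
      exact this
    calc ‖x‖ = ‖(↑U⁻¹ : H →L[ℂ] H) (T x)‖ := by rw [h1]
      _ ≤ ‖(↑U⁻¹ : H →L[ℂ] H)‖ * ‖T x‖ := ContinuousLinearMap.le_opNorm _ _
      _ ≤ _ := by nlinarith [norm_nonneg (T x)]
  set m := ‖(↑U⁻¹ : H →L[ℂ] H)‖ + 1
  have hm : 0 < m := by positivity
  refine ⟨(m ^ 2)⁻¹, by positivity, fun x => ?_⟩
  have h2 : inner ℂ x (A x) = inner ℂ (T x) (T x) := by
    rw [← hTT]
    have := ContinuousLinearMap.adjoint_inner_left T (T x) x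
    rw [← ContinuousLinearMap.star_eq_adjoint, hTsa.star_eq] at this
    exact this.symm
  rw [h2, inner_self_eq_norm_sq, inv_mul_le_iff₀ (by positivity), ← mul_pow]
  gcongr
  exact key x

theorem IsHPD.exists_coercive {A : EllTwo →L[ℂ] EllTwo} (hA : IsHPD A) :
    ∃ δ : ℝ, 0 < δ ∧ ∀ x : EllTwo, δ * ‖x‖ ^ 2 ≤ RCLike.re (inner ℂ x (A x)) :=
  exists_coercive_of_isPositive_of_isUnit hA.1 hA.2

theorem hasSum_apply {L : EllTwo →L[ℂ] EllTwo} {a : ℤ → ℂ} (hL : IsToeplitz L a) (x : EllTwo)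
    (k : ℤ) : HasSum (fun l => a (k - l) * x l) (L x k) := by
  have h := lp.hasSum_single (E := fun _ : ℤ => ℂ) (p := 2) (by simp) x
  have h1 := h.mapL ((lp.evalCLM ℂ (fun _ : ℤ => ℂ) 2 k).comp L)
  have e : (fun l => a (k - l) * x l) = fun l => ((lp.evalCLM ℂ (fun _ : ℤ => ℂ) 2 k).comp L)
      (lp.single (E := fun _ : ℤ => ℂ) 2 l (x l)) := by
    funext l
    have : lp.single (E := fun _ : ℤ => ℂ) 2 l (x l) = x l • lp.single 2 l (1 : ℂ) := by
      rw [← lp.single_smul]; simp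
    rw [this, map_smul, ← hL k l]
    simp only [entry, ContinuousLinearMap.comp_apply, smul_eq_mul, mul_comm (x l)]
    rfl
  rw [e]
  exact h1

theorem hasSum_norm_sq (x : EllTwo) : HasSum (fun k => ‖x k‖ ^ 2) (‖x‖ ^ 2) := by
  have h := lp.hasSum_norm (E := fun _ : ℤ => ℂ) (p := 2) (by simp) x
  simpa using h

/-! ### Exponential decay of the solution -/

theorem summable_exp_neg_abs {s : ℝ} (hs : 0 < s) :
    Summable fun j : ℤ => Real.exp (-s * |(j : ℝ)|) := by
  have h : Summable fun n : ℕ => Real.exp (-s * (n : ℝ)) := by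
    have := Real.summable_exp_nat_mul_iff.2 (neg_lt_zero.2 hs)
    simpa [mul_comm] using this
  refine Summable.of_nat_of_neg ?_ ?_ <;> simpa using h

theorem mul_exp_neg_le {s t : ℝ} (hs : 0 < s) :
    t * Real.exp (-s * t) ≤ 2 / s * Real.exp (-(s / 2) * t) := by
  have h1 : s / 2 * t ≤ Real.exp (s / 2 * t) := by linarith [Real.add_one_le_exp (s / 2 * t)]
  have h2 : Real.exp (-s * t) = Real.exp (-(s / 2) * t) * Real.exp (-(s / 2) * t) := by
    rw [← Real.exp_add]; ring_nf
  have h3 : Real.exp (s / 2 * t) * Real.exp (-(s / 2) * t) = 1 := by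
    rw [← Real.exp_add]; simp
  have h4 := Real.exp_pos (-(s / 2) * t)
  have h5 : t * Real.exp (-(s / 2) * t) ≤ 2 / s := by
    rw [le_div_iff₀ hs]
    nlinarith
  rw [h2, ← mul_assoc]
  gcongr

theorem summable_abs_mul_exp_neg_abs {s : ℝ} (hs : 0 < s) :
    Summable fun j : ℤ => |(j : ℝ)| * Real.exp (-s * |(j : ℝ)|) :=
  .of_nonneg_of_le (fun _ => by positivity) (fun _ => mul_exp_neg_le hs)
    ((summable_exp_neg_abs (half_pos hs)).mul_left _)

/-- Schur's test for convolution-dominated quadratic forms. -/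
theorem summable_and_tsum_mul_conv_le {w u : ℤ → ℝ} (hw0 : ∀ j, 0 ≤ w j) (hw : Summable w)
    (hu0 : ∀ j, 0 ≤ u j) (hu : Summable fun k => u k ^ 2) :
    (∀ k, Summable fun l => w (k - l) * u l) ∧
    (Summable fun k => u k * ∑' l, w (k - l) * u l) ∧
    ∑' k, u k * ∑' l, w (k - l) * u l ≤ (∑' j, w j) * ∑' k, u k ^ 2 := by
  have h0 : Summable fun p : ℤ × ℤ => w p.1 * u p.2 ^ 2 :=
    hw.mul_of_nonneg hu hw0 fun _ => sq_nonneg _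
  have h0t : ∑' p : ℤ × ℤ, w p.1 * u p.2 ^ 2 = (∑' j, w j) * ∑' k, u k ^ 2 :=
    (hw.tsum_mul_tsum hu h0).symm
  let e1 : ℤ × ℤ ≃ ℤ × ℤ :=
    ⟨fun p => (p.1 - p.2, p.2), fun p => (p.1 + p.2, p.2), fun p => by simp, fun p => by simp⟩
  let e2 : ℤ × ℤ ≃ ℤ × ℤ :=
    ⟨fun p => (p.1 - p.2, p.1), fun p => (p.2, p.2 - p.1), fun p => by simp, fun p => by simp⟩
  have h1 : Summable fun p : ℤ × ℤ => w (p.1 - p.2) * u p.2 ^ 2 := 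
    (e1.summable_iff (f := fun p : ℤ × ℤ => w p.1 * u p.2 ^ 2)).2 h0
  have h2 : Summable fun p : ℤ × ℤ => w (p.1 - p.2) * u p.1 ^ 2 := 
    (e2.summable_iff (f := fun p : ℤ × ℤ => w p.1 * u p.2 ^ 2)).2 h0
  have h1t : ∑' p : ℤ × ℤ, w (p.1 - p.2) * u p.2 ^ 2 = (∑' j, w j) * ∑' k, u k ^ 2 := by
    rw [← h0t]; exact e1.tsum_eq (fun p : ℤ × ℤ => w p.1 * u p.2 ^ 2)
  have h2t : ∑' p : ℤ × ℤ, w (p.1 - p.2) * u p.1 ^ 2 = (∑' j, w j) * ∑' k, u k ^ 2 := by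
    rw [← h0t]; exact e2.tsum_eq (fun p : ℤ × ℤ => w p.1 * u p.2 ^ 2)
  -- AM-GM separates the two factors; the shears `e1` and `e2` of `ℤ × ℤ` sum each square exactly.
  have hle : ∀ p : ℤ × ℤ, u p.1 * (w (p.1 - p.2) * u p.2) ≤
      2⁻¹ * (w (p.1 - p.2) * u p.2 ^ 2 + w (p.1 - p.2) * u p.1 ^ 2) := fun p => by
    nlinarith [mul_nonneg (hw0 (p.1 - p.2)) (sq_nonneg (u p.1 - u p.2))]
  have hs := (h1.add h2).mul_left 2⁻¹
  have h3 : Summable fun p : ℤ × ℤ => u p.1 * (w (p.1 - p.2) * u p.2) :=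
    .of_nonneg_of_le
      (fun p => mul_nonneg (hu0 _) (mul_nonneg (hw0 _) (hu0 _))) hle hs
  refine ⟨fun k => ?_, ?_, ?_⟩
  · have h4 : Summable fun l => w (k - l) * u l ^ 2 := h1.prod_factor k
    have h5 : Summable fun l => w (k - l) := by
      exact ((Equiv.subLeft k).summable_iff (f := w)).2 hw
    refine .of_nonneg_of_le (fun l => mul_nonneg (hw0 _) (hu0 _)) (fun l => ?_) (h4.add h5)
    nlinarith [mul_nonneg (hw0 (k - l)) (sq_nonneg (u l - 1)), mul_nonneg (hw0 (k - l)) (hu0 l)]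
  · simpa only [tsum_mul_left] using h3.prod
  · have h6 : ∑' k, u k * ∑' l, w (k - l) * u l
        = ∑' p : ℤ × ℤ, u p.1 * (w (p.1 - p.2) * u p.2) := by
      rw [h3.tsum_prod]; simp only [tsum_mul_left]
    rw [h6]
    refine (h3.tsum_le_tsum hle hs).trans ?_
    rw [tsum_mul_left, h1.tsum_add h2, h1t, h2t]
    linarith

theorem abs_exp_sub_one_le_abs_mul_exp_abs (t : ℝ) :
    |Real.exp t - 1| ≤ |t| * Real.exp |t| := by
  rcases le_total 0 t with ht | ht
  · have h1 := Real.add_one_le_exp (-t)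
    have h2 : Real.exp t * Real.exp (-t) = 1 := by rw [← Real.exp_add]; simp
    rw [abs_of_nonneg ht, abs_of_nonneg (by linarith [Real.one_le_exp ht])]
    nlinarith [Real.exp_pos t]
  · rw [abs_of_nonpos ht, abs_of_nonpos (by linarith [Real.exp_le_one_iff.2 ht])]
    have h1 := Real.add_one_le_exp t
    have h2 : 1 ≤ Real.exp (-t) := Real.one_le_exp (by linarith)
    nlinarith

/-- A Combes–Thomas argument: conjugating `L` by a slowly growing exponential weight perturbs it by
less than its coercivity constant, so the weighted solution has bounded norm. -/
theorem exists_exp_decay_of_apply_eq {L : EllTwo →L[ℂ] EllTwo} {a : ℤ → ℂ}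
    (hL : IsToeplitz L a) {δ : ℝ} (hδ : 0 < δ)
    (hco : ∀ x : EllTwo, δ * ‖x‖ ^ 2 ≤ RCLike.re (inner ℂ x (L x)))
    {C γ : ℝ} (hC : 0 < C) (hγ : 0 < γ) (ha : ∀ j : ℤ, ‖a j‖ ≤ C * Real.exp (-γ * |(j : ℝ)|))
    {x y : EllTwo} (hxy : L x = y) {c' : ℝ}
    (hy : ∀ k : ℤ, ‖y k‖ ≤ c' * Real.exp (-γ * |(k : ℝ)|)) :
    ∃ ε : ℝ, 0 < ε ∧ ε < γ ∧ ∃ M : ℝ, 0 ≤ M ∧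
      ∀ k : ℤ, ‖x k‖ ≤ M * Real.exp (-ε * |(k : ℝ)|) := by
  have hγ2 : 0 < γ / 2 := half_pos hγ
  have hKs := summable_abs_mul_exp_neg_abs hγ2
  set K : ℝ := ∑' j : ℤ, |(j : ℝ)| * Real.exp (-(γ / 2) * |(j : ℝ)|) with hK
  have hK0 : 0 ≤ K := tsum_nonneg fun _ => by positivity
  -- The last condition makes the commutator with the weight cost at most `δ / 2`; `ε ≤ γ / 2`
  -- leaves half of the decay of `a` for summability.
  obtain ⟨ε, hε, hεγ, hεK⟩ : ∃ ε : ℝ, 0 < ε ∧ ε ≤ γ / 2 ∧ C * ε * K ≤ δ / 2 := by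
    refine ⟨min (γ / 2) (δ / (2 * C * (K + 1))), by positivity, min_le_left _ _, ?_⟩
    have h1 : min (γ / 2) (δ / (2 * C * (K + 1))) ≤ δ / (2 * C * (K + 1)) := min_le_right _ _
    rw [le_div_iff₀ (by positivity)] at h1
    have h2 : 0 < min (γ / 2) (δ / (2 * C * (K + 1))) := by positivity
    nlinarith [mul_pos hC h2]
  set w : ℤ → ℝ := fun j => C * ε * (|(j : ℝ)| * Real.exp (-(γ / 2) * |(j : ℝ)|)) with hw
  have hw0 : ∀ j, 0 ≤ w j := fun j => by positivity
  have hws : Summable w := hKs.mul_left _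
  have hwt : ∑' j, w j ≤ δ / 2 := by rw [hw, tsum_mul_left]; exact hεK
  set g : ℤ → ℝ := fun k => c' * Real.exp (-(γ - ε) * |(k : ℝ)|) with hg
  have hg2 : Summable fun k => g k ^ 2 := by
    have h := (summable_exp_neg_abs (s := 2 * (γ - ε)) (by linarith)).mul_left (c' ^ 2)
    refine h.congr fun k => ?_
    simp only [hg, mul_pow]
    rw [← Real.exp_nat_mul]
    congr 2
    push_cast; ring
  set Y := ∑' k, g k ^ 2 with hY
  have hY0 : 0 ≤ Y := tsum_nonneg fun _ => sq_nonneg _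
  refine ⟨ε, hε, by linarith, √(4 * Y / δ ^ 2), Real.sqrt_nonneg _, fun k₀ => ?_⟩
  -- Capping the weight at `|k₀|` keeps the weighted sequence in `ℓ²`. The Lipschitz constant stays
  -- `ε`, so the bounds do not depend on `k₀`.
  set φ : ℤ → ℝ := fun k => ε * min |(k : ℝ)| |(k₀ : ℝ)| with hφ
  have hφsub : ∀ k l : ℤ, |φ k - φ l| ≤ ε * |((k - l : ℤ) : ℝ)| := by
    intro k l
    rw [hφ]
    simp only [← mul_sub, abs_mul, abs_of_pos hε]
    refine mul_le_mul_of_nonneg_left ?_ hε.le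
    refine (abs_min_sub_min_le_max |(k : ℝ)| |(k₀ : ℝ)| |(l : ℝ)| |(k₀ : ℝ)|).trans ?_
    simp only [sub_self, abs_zero]
    rw [max_eq_left (abs_nonneg _)]
    push_cast
    exact abs_abs_sub_abs_le _ _
  have hmem : Memℓp (fun k : ℤ => ((Real.exp (φ k) : ℝ) : ℂ) * x k) 2 := by
    refine memℓp_gen ?_
    have h := (hasSum_norm_sq x).summable.mul_left (Real.exp (ε * |(k₀ : ℝ)|) ^ 2)
    refine .of_nonneg_of_le (fun k => by positivity) (fun k => ?_) h
    have : ‖((Real.exp (φ k) : ℝ) : ℂ) * x k‖ = Real.exp (φ k) * ‖x k‖ := by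
      rw [norm_mul, Complex.norm_real, Real.norm_eq_abs, Real.abs_exp]
    rw [this]
    simp only [ENNReal.toReal_ofNat, Real.rpow_ofNat, mul_pow]
    gcongr
    exact mul_le_mul_of_nonneg_left (min_le_right _ _) hε.le
  let u : EllTwo := ⟨fun k => ((Real.exp (φ k) : ℝ) : ℂ) * x k, hmem⟩
  have hu : ∀ k, u k = ((Real.exp (φ k) : ℝ) : ℂ) * x k := fun k => rfl
  have hun : ∀ k, ‖u k‖ = Real.exp (φ k) * ‖x k‖ := fun k => by
    rw [hu, norm_mul, Complex.norm_real, Real.norm_eq_abs, Real.abs_exp]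
  obtain ⟨hsch1, hsch2, hsch3⟩ := summable_and_tsum_mul_conv_le hw0 hws
    (u := fun k => ‖u k‖) (fun k => norm_nonneg _) (hasSum_norm_sq u).summable
  have hLu : ∀ k, ‖L u k‖ ≤ g k + ∑' l, w (k - l) * ‖u l‖ := by
    intro k
    have h1 := hasSum_apply hL u k
    have h2 := (hasSum_apply hL x k).mul_left ((Real.exp (φ k) : ℝ) : ℂ)
    have h3 := h1.sub h2
    have h4 : ‖L u k - ((Real.exp (φ k) : ℝ) : ℂ) * L x k‖ ≤ ∑' l, w (k - l) * ‖u l‖ := by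
      rw [← h3.tsum_eq]
      refine tsum_of_norm_bounded (hsch1 k).hasSum fun l => ?_
      have h5 : a (k - l) * u l - ((Real.exp (φ k) : ℝ) : ℂ) * (a (k - l) * x l)
          = -(a (k - l) * ((Real.exp (φ k - φ l) - 1 : ℝ) : ℂ) * u l) := by
        have : ((Real.exp (φ k) : ℝ) : ℂ) =
            ((Real.exp (φ k - φ l) : ℝ) : ℂ) * ((Real.exp (φ l) : ℝ) : ℂ) := by
          rw [← Complex.ofReal_mul, ← Real.exp_add]; simp
        rw [hu, this]; push_cast; ring
      rw [h5, norm_neg, norm_mul, norm_mul, Complex.norm_real, Real.norm_eq_abs]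
      gcongr
      have h6 : |Real.exp (φ k - φ l) - 1| ≤
          ε * |((k - l : ℤ) : ℝ)| * Real.exp (ε * |((k - l : ℤ) : ℝ)|) :=
        (abs_exp_sub_one_le_abs_mul_exp_abs _).trans (by gcongr <;> exact hφsub k l)
      calc ‖a (k - l)‖ * |Real.exp (φ k - φ l) - 1|
          ≤ (C * Real.exp (-γ * |((k - l : ℤ) : ℝ)|)) *
            (ε * |((k - l : ℤ) : ℝ)| * Real.exp (ε * |((k - l : ℤ) : ℝ)|)) := by
            gcongr; exact ha _
        _ = C * ε * (|((k - l : ℤ) : ℝ)| * Real.exp (-(γ - ε) * |((k - l : ℤ) : ℝ)|)) := by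
            have : -(γ - ε) * |((k - l : ℤ) : ℝ)| =
              -γ * |((k - l : ℤ) : ℝ)| + ε * |((k - l : ℤ) : ℝ)| := by ring
            rw [this, Real.exp_add]; ring
        _ ≤ w (k - l) := by
            simp only [hw]
            gcongr
            linarith
    have h7 : ‖((Real.exp (φ k) : ℝ) : ℂ) * L x k‖ ≤ g k := by
      rw [hxy, norm_mul, Complex.norm_real, Real.norm_eq_abs, Real.abs_exp]
      have hc : 0 ≤ c' := by
        have := (norm_nonneg _).trans (hy 0)
        simpa using this
      calc Real.exp (φ k) * ‖y k‖
          ≤ Real.exp (ε * |(k : ℝ)|) * (c' * Real.exp (-γ * |(k : ℝ)|)) := by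
            gcongr
            · exact mul_le_mul_of_nonneg_left (min_le_left _ _) hε.le
            · exact hy k
        _ = g k := by
            simp only [hg]
            rw [show -(γ - ε) * |(k : ℝ)| = ε * |(k : ℝ)| + -γ * |(k : ℝ)| by ring, Real.exp_add]
            ring
    calc ‖L u k‖ = ‖((Real.exp (φ k) : ℝ) : ℂ) * L x k +
          (L u k - ((Real.exp (φ k) : ℝ) : ℂ) * L x k)‖ := by congr 1; ring
      _ ≤ _ := (norm_add_le _ _).trans (add_le_add h7 h4)
  have hnu := hasSum_norm_sq u
  have hA : Summable fun k => δ / 4 * ‖u k‖ ^ 2 + δ⁻¹ * g k ^ 2 :=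
    (hnu.summable.mul_left _).add (hg2.mul_left _)
  -- Young's inequality spends `δ / 4` on the source and Schur's test `δ / 2` on the commutator,
  -- leaving `δ / 4` to absorb.
  have hform : RCLike.re (inner ℂ u (L u)) ≤ δ / 4 * ‖u‖ ^ 2 + δ⁻¹ * Y + δ / 2 * ‖u‖ ^ 2 := by
    refine (RCLike.re_le_norm _).trans ?_
    rw [← (lp.hasSum_inner (𝕜 := ℂ) u (L u)).tsum_eq]
    have h1 : ∀ k, ‖inner ℂ (u k) (L u k)‖ ≤ (δ / 4 * ‖u k‖ ^ 2 + δ⁻¹ * g k ^ 2) +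
        ‖u k‖ * ∑' l, w (k - l) * ‖u l‖ := by
      intro k
      refine (norm_inner_le_norm _ _).trans ?_
      refine (mul_le_mul_of_nonneg_left (hLu k) (norm_nonneg _)).trans ?_
      rw [mul_add]
      gcongr
      have h2 : δ / 4 * ‖u k‖ ^ 2 + δ⁻¹ * g k ^ 2 - ‖u k‖ * g k
          = δ⁻¹ * (δ / 2 * ‖u k‖ - g k) ^ 2 := by field_simp; ring
      have h3 : 0 ≤ δ⁻¹ * (δ / 2 * ‖u k‖ - g k) ^ 2 := by positivity
      linarith
    refine (tsum_of_norm_bounded (hA.add hsch2).hasSum h1).trans ?_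
    rw [hA.tsum_add hsch2, (hnu.summable.mul_left _).tsum_add (hg2.mul_left _), tsum_mul_left,
      tsum_mul_left, hnu.tsum_eq]
    rw [hnu.tsum_eq] at hsch3
    gcongr
    exact hsch3.trans (by gcongr)
  have hfin : ‖u‖ ^ 2 ≤ 4 * Y / δ ^ 2 := by
    have h1 := (hco u).trans hform
    have h2 : δ / 4 * ‖u‖ ^ 2 ≤ δ⁻¹ * Y := by linarith
    calc ‖u‖ ^ 2 = 4 / δ * (δ / 4 * ‖u‖ ^ 2) := by field_simp
      _ ≤ 4 / δ * (δ⁻¹ * Y) := by gcongr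
      _ = _ := by field_simp
  have h1 : Real.exp (ε * |(k₀ : ℝ)|) * ‖x k₀‖ ≤ √(4 * Y / δ ^ 2) := by
    have h2 : ‖u k₀‖ ≤ ‖u‖ := lp.norm_apply_le_norm (by simp) u k₀
    rw [hun] at h2
    simp only [hφ, min_self] at h2
    exact h2.trans (Real.le_sqrt_of_sq_le hfin)
  calc ‖x k₀‖ = Real.exp (ε * |(k₀ : ℝ)|) * ‖x k₀‖ * Real.exp (-ε * |(k₀ : ℝ)|) := by
        rw [mul_right_comm, ← Real.exp_add]; simp
    _ ≤ _ := by gcongr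

/-! ### Coercive matrices -/

/-- The real part of the quadratic form of `A` is bounded below by `δ` times the squared
euclidean norm. -/
def IsCoercive {ι : Type*} [Fintype ι] (δ : ℝ) (A : Matrix ι ι ℂ) : Prop :=
  ∀ v : ι → ℂ, δ * ∑ i, ‖v i‖ ^ 2 ≤ (star v ⬝ᵥ A *ᵥ v).re

namespace IsCoercive
variable {ι : Type*} [Fintype ι] {δ : ℝ} {A : Matrix ι ι ℂ}

/-- The stability estimate: Young's inequality on the form, with half of the coercive term absorbed.
-/
theorem sum_norm_sq_le (h : IsCoercive δ A) (hδ : 0 < δ) (v : ι → ℂ) :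
    ∑ i, ‖v i‖ ^ 2 ≤ (δ ^ 2)⁻¹ * ∑ i, ‖(A *ᵥ v) i‖ ^ 2 := by
  have h1 : (star v ⬝ᵥ A *ᵥ v).re ≤
      ∑ i, (δ / 2 * ‖v i‖ ^ 2 + (2 * δ)⁻¹ * ‖(A *ᵥ v) i‖ ^ 2) := by
    refine (Complex.re_le_norm _).trans ((norm_sum_le _ _).trans ?_)
    refine Finset.sum_le_sum fun i _ => ?_
    rw [norm_mul, Pi.star_apply, norm_star]
    have h2 : δ / 2 * ‖v i‖ ^ 2 + (2 * δ)⁻¹ * ‖(A *ᵥ v) i‖ ^ 2 - ‖v i‖ * ‖(A *ᵥ v) i‖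
        = (2 * δ)⁻¹ * (δ * ‖v i‖ - ‖(A *ᵥ v) i‖) ^ 2 := by field_simp; ring
    have h3 : 0 ≤ (2 * δ)⁻¹ * (δ * ‖v i‖ - ‖(A *ᵥ v) i‖) ^ 2 := by positivity
    linarith
  have h4 := (h v).trans h1
  rw [Finset.sum_add_distrib, ← Finset.mul_sum, ← Finset.mul_sum] at h4
  have h5 : δ / 2 * ∑ i, ‖v i‖ ^ 2 ≤ (2 * δ)⁻¹ * ∑ i, ‖(A *ᵥ v) i‖ ^ 2 := by linarith
  calc ∑ i, ‖v i‖ ^ 2 = 2 / δ * (δ / 2 * ∑ i, ‖v i‖ ^ 2) := by field_simp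
    _ ≤ 2 / δ * ((2 * δ)⁻¹ * ∑ i, ‖(A *ᵥ v) i‖ ^ 2) := by gcongr
    _ = _ := by field_simp

theorem isUnit [DecidableEq ι] (h : IsCoercive δ A) (hδ : 0 < δ) : IsUnit A := by
  rw [← Matrix.mulVec_injective_iff_isUnit]
  refine (injective_iff_map_eq_zero A.mulVecLin).2 fun v hv => ?_
  rw [Matrix.mulVecLin_apply] at hv
  have h1 := h.sum_norm_sq_le hδ v
  simp only [hv, Pi.zero_apply, norm_zero, ne_eq, OfNat.ofNat_ne_zero, not_false_eq_true,
    zero_pow, Finset.sum_const_zero, mul_zero] at h1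
  have h2 := (Finset.sum_eq_zero_iff_of_nonneg fun i _ => sq_nonneg ‖v i‖).1
    (le_antisymm h1 (Finset.sum_nonneg fun i _ => sq_nonneg _))
  funext i
  simpa using h2 i (Finset.mem_univ i)

end IsCoercive

/-! ### Central windows and finite sections -/

theorem windowPos_injective (n : ℕ) : Function.Injective (windowPos n) := fun k l h => by
  simp only [windowPos] at h
  exact Fin.ext (by omega)

theorem windowExtend_apply_windowPos {n : ℕ} (z : Fin n → ℂ) (k : Fin n) :
    windowExtend n z (windowPos n k) = z k := by
  rw [windowExtend, lp.coeFn_sum, Finset.sum_apply, Finset.sum_eq_single k]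
  · exact lp.single_apply_self _ _ _
  · exact fun l _ hl => lp.single_apply_ne _ _ _ fun h => hl (windowPos_injective n h.symm)
  · simp

theorem windowExtend_apply_of_notMem {n : ℕ} (z : Fin n → ℂ) {j : ℤ}
    (hj : j ∉ Set.range (windowPos n)) : windowExtend n z j = 0 := by
  rw [windowExtend, lp.coeFn_sum, Finset.sum_apply]
  exact Finset.sum_eq_zero fun l _ => lp.single_apply_ne _ _ _ fun h => hj ⟨l, h.symm⟩

theorem inner_windowExtend_left {n : ℕ} (z : Fin n → ℂ) (x : EllTwo) :
    inner ℂ (windowExtend n z) x = ∑ k, inner ℂ (z k) (x (windowPos n k)) := by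
  rw [windowExtend, sum_inner]
  exact Finset.sum_congr rfl fun k _ => lp.inner_single_left _ _ _

theorem norm_windowExtend_sq {n : ℕ} (z : Fin n → ℂ) :
    ‖windowExtend n z‖ ^ 2 = ∑ k, ‖z k‖ ^ 2 := by
  rw [← inner_self_eq_norm_sq (𝕜 := ℂ), inner_windowExtend_left]
  simp only [windowExtend_apply_windowPos, map_sum, inner_self_eq_norm_sq]

theorem windowExtend_sub {n : ℕ} (z z' : Fin n → ℂ) :
    windowExtend n (z - z') = windowExtend n z - windowExtend n z' := by
  simp only [windowExtend, ← Finset.sum_sub_distrib, ← lp.single_sub, Pi.sub_apply]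

theorem hasSum_windowExtend {n : ℕ} (z : Fin n → ℂ) (f : ℤ → ℂ) :
    HasSum (fun l => f l * windowExtend n z l) (∑ l, f (windowPos n l) * z l) := by
  have h := hasSum_sum_of_ne_finset_zero (L := .unconditional ℤ) (f := fun l => f l * windowExtend n z l)
    (s := Finset.univ.map ⟨windowPos n, windowPos_injective n⟩) fun j hj => by
      rw [windowExtend_apply_of_notMem z (by simpa using hj), mul_zero]
  simpa [windowExtend_apply_windowPos] using h

theorem windowPos_sub_windowPos {n : ℕ} (k l : Fin n) :
    windowPos n k - windowPos n l = (k : ℤ) - (l : ℤ) := by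
  simp [windowPos]

theorem apply_windowExtend {L : EllTwo →L[ℂ] EllTwo} {a : ℤ → ℂ} (hL : IsToeplitz L a)
    {n : ℕ} (z : Fin n → ℂ) (k : Fin n) :
    L (windowExtend n z) (windowPos n k) = (toeplitzSection a n *ᵥ z) k := by
  refine (hasSum_apply hL _ _).unique ?_
  have := hasSum_windowExtend z (fun l => a (windowPos n k - l))
  simp only [windowPos_sub_windowPos] at this
  exact this

theorem isCoercive_toeplitzSection {L : EllTwo →L[ℂ] EllTwo} {a : ℤ → ℂ} (hL : IsToeplitz L a)
    {δ : ℝ} (hco : ∀ x : EllTwo, δ * ‖x‖ ^ 2 ≤ RCLike.re (inner ℂ x (L x))) (n : ℕ) :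
    IsCoercive δ (toeplitzSection a n) := by
  intro v
  have h := hco (windowExtend n v)
  rw [norm_windowExtend_sq, inner_windowExtend_left] at h
  simp only [apply_windowExtend hL] at h
  refine h.trans (le_of_eq ?_)
  simp [dotProduct, RCLike.inner_apply, mul_comm]

theorem conj_toeplitz {L : EllTwo →L[ℂ] EllTwo} {a : ℤ → ℂ} (hL : IsToeplitz L a)
    (hpos : L.IsPositive) (j : ℤ) : star (a j) = a (-j) := by
  have h1 : ∀ k l, inner ℂ (lp.single (E := fun _ : ℤ => ℂ) 2 k (1 : ℂ))
      (L (lp.single 2 l (1 : ℂ))) = a (k - l) := by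
    intro k l
    rw [lp.inner_single_left, ← hL k l]
    simp [entry]
  have h2 := hpos.isSymmetric (lp.single (E := fun _ : ℤ => ℂ) 2 0 (1 : ℂ))
    (lp.single (E := fun _ : ℤ => ℂ) 2 j (1 : ℂ))
  have h3 := h1 j 0
  have h4 := h1 0 j
  rw [sub_zero] at h3
  rw [zero_sub] at h4
  rw [← h3, ← h4, ← starRingEnd_apply, inner_conj_symm]
  exact h2

/-! ### Coercivity of the circulant embedding -/

/-- The entries of the circulant matrix of order `2 * n` built from `a_{-(n-1)}, …, a_{n-1}`. -/
def circulantSymbol (a : ℤ → ℂ) (n : ℕ) (d : ZMod (2 * n)) : ℂ :=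
  if |d.valMinAbs| < n then a d.valMinAbs else 0

theorem valMinAbs_intCast_of_abs_lt {n : ℕ} [NeZero (2 * n)] {t : ℤ} (ht : |t| < n) :
    ((t : ZMod (2 * n))).valMinAbs = t := by
  rw [abs_lt] at ht
  rw [ZMod.valMinAbs_spec]
  refine ⟨rfl, ?_, ?_⟩ <;> push_cast <;> omega

theorem circulantSymbol_intCast {a : ℤ → ℂ} {n : ℕ} [NeZero (2 * n)] {t : ℤ} (ht : |t| < n) :
    circulantSymbol a n t = a t := by
  rw [circulantSymbol, valMinAbs_intCast_of_abs_lt ht, if_pos ht]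

/-- The class of `n` is the only one without a representative in `(-n, n)`; it is the diagonal of
`B_n`, so the value here encodes `b₀ = 0`. -/
theorem circulantSymbol_natCast_self {a : ℤ → ℂ} {n : ℕ} [NeZero (2 * n)] :
    circulantSymbol a n (n : ZMod (2 * n)) = 0 := by
  have h : (n : ZMod (2 * n)).valMinAbs = n := by
    rw [ZMod.valMinAbs_spec]
    have := NeZero.pos (2 * n)
    refine ⟨by simp, ?_, ?_⟩ <;> push_cast <;> omega
  rw [circulantSymbol, h, if_neg (by simp)]

/-- The number of pairs in `Fin n` whose difference is `d` modulo `2 * n`. -/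
def diffCount (n : ℕ) (d : ZMod (2 * n)) : ℕ :=
  (Finset.univ.filter fun p : Fin n × Fin n =>
    (((p.1 : ℤ) - (p.2 : ℤ) : ℤ) : ZMod (2 * n)) = d).card

/-- The second index determines the first, since two elements of `Fin n` congruent modulo `2 * n`
coincide. -/
theorem diffCount_le (n : ℕ) (d : ZMod (2 * n)) : diffCount n d ≤ n := by
  have h : diffCount n d ≤ (Finset.univ : Finset (Fin n)).card := by
    refine Finset.card_le_card_of_injOn (fun p => p.2) (fun _ _ => Finset.mem_coe.2 (Finset.mem_univ _)) ?_
    rintro ⟨k, l⟩ h1 ⟨k', l'⟩ h2 (rfl : l = l')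
    simp only [Finset.coe_filter, Finset.mem_univ, true_and, Set.mem_ofPred_eq] at h1 h2
    rw [← h2, ZMod.intCast_eq_intCast_iff] at h1
    have h4 := h1.symm.dvd
    obtain ⟨q, hq⟩ := h4
    push_cast at hq
    have hk := k.2
    have hk' := k'.2
    have hq0 : q = 0 := by
      have h5 : q < 1 := by by_contra h; nlinarith
      have h6 : -1 < q := by by_contra h; nlinarith
      omega
    subst hq0
    have : k = k' := Fin.ext (by omega)
    rw [this]
  simpa using h

theorem le_diffCount_add (n : ℕ) [NeZero (2 * n)] (d : ZMod (2 * n)) :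
    n ≤ diffCount n d + d.valMinAbs.natAbs := by
  set t := d.valMinAbs with ht
  have hd : (t : ZMod (2 * n)) = d := d.coe_valMinAbs
  suffices h : (Finset.univ : Finset (Fin (n - t.natAbs))).card ≤ diffCount n d by
    rw [Finset.card_fin] at h; omega
  -- Translates of the pair `(t⁺, t⁻)` have difference `t`, and `n - |t|` of them fit.
  refine Finset.card_le_card_of_injOn
    (fun l => (⟨l + t.toNat, by omega⟩, ⟨l + (-t).toNat, by omega⟩)) ?_ ?_
  · intro l _
    simp only [Finset.coe_filter, Finset.mem_univ, true_and, Set.mem_ofPred_eq]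
    rw [← hd]
    congr 1
    push_cast
    omega
  · intro l _ l' _ h
    simp only [Prod.mk.injEq, Fin.mk.injEq] at h
    exact Fin.ext (by omega)

/-- Summing the form of `A_n` over all windows of length `n` on the cycle counts the difference `d`
exactly `diffCount n d` times. This differs from `n` by at most `|d|`, so after division by `n` the
error is at most the first moment of `a` over `n`. -/
theorem isCoercive_circulant {a : ℤ → ℂ} {δ : ℝ} {n : ℕ} [NeZero (2 * n)]
    (hA : IsCoercive δ (toeplitzSection a n))
    (hs : Summable fun j : ℤ => |(j : ℝ)| * ‖a j‖) :
    IsCoercive (δ - (∑' j : ℤ, |(j : ℝ)| * ‖a j‖) / n)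
      (Matrix.of fun i j : ZMod (2 * n) => circulantSymbol a n (i - j)) := by
  intro v
  have hn : 0 < (n : ℝ) := by
    have := NeZero.pos (2 * n)
    exact_mod_cast (by omega : 0 < n)
  set K := ∑' j : ℤ, |(j : ℝ)| * ‖a j‖ with hK
  set c := circulantSymbol a n with hc
  set V := ∑ i, ‖v i‖ ^ 2 with hV
  have hshift : ∀ d, ∑ s, ‖v (s + d)‖ ^ 2 = V := fun d =>
    Equiv.sum_comp (Equiv.addRight d) fun s => ‖v s‖ ^ 2
  let R : ZMod (2 * n) → ℂ := fun d => ∑ s, star (v (s + d)) * v s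
  have hR : ∀ d, ‖R d‖ ≤ V := by
    intro d
    calc ‖R d‖ ≤ ∑ s, (2⁻¹ * ‖v (s + d)‖ ^ 2 + 2⁻¹ * ‖v s‖ ^ 2) := by
          refine (norm_sum_le _ _).trans (Finset.sum_le_sum fun s _ => ?_)
          rw [norm_mul, norm_star]
          nlinarith [sq_nonneg (‖v (s + d)‖ - ‖v s‖)]
      _ = V := by
          rw [Finset.sum_add_distrib, ← Finset.mul_sum, ← Finset.mul_sum, hshift, ← hV]; ring
  have hform : star v ⬝ᵥ (Matrix.of fun i j => c (i - j)) *ᵥ v = ∑ d, c d * R d := by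
    simp only [dotProduct, mulVec, Matrix.of_apply, Pi.star_apply, Finset.mul_sum, R]
    rw [Finset.sum_comm]
    conv_rhs => rw [Finset.sum_comm]
    refine Finset.sum_congr rfl fun j _ => ?_
    rw [← Equiv.sum_comp (Equiv.addLeft j)]
    refine Finset.sum_congr rfl fun d _ => ?_
    simp only [Equiv.coe_addLeft, add_sub_cancel_left]
    ring
  -- Each point of the cycle lies in `n` of the `2 * n` windows, whence `n * V`; grouping pairs by
  -- their difference gives the right side.
  have hwin : δ * (n * V) ≤ (∑ d, (diffCount n d : ℂ) * (c d * R d)).re := by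
    have h1 : ∀ s : ZMod (2 * n), δ * ∑ k : Fin n, ‖v (s + (k : ℕ))‖ ^ 2 ≤
        (∑ p : Fin n × Fin n, star (v (s + (p.1 : ℕ))) *
          (a ((p.1 : ℤ) - (p.2 : ℤ)) * v (s + (p.2 : ℕ)))).re := by
      intro s
      refine (hA fun k => v (s + (k : ℕ))).trans (le_of_eq ?_)
      rw [Fintype.sum_prod_type]
      simp [dotProduct, mulVec, toeplitzSection, Finset.mul_sum]
    have h2 := Finset.sum_le_sum fun s (_ : s ∈ Finset.univ) => h1 s
    have h0 : ∑ s : ZMod (2 * n), ∑ k : Fin n, ‖v (s + (k : ℕ))‖ ^ 2 = n * V := by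
      rw [Finset.sum_comm]
      simp [hshift]
    rw [← Finset.mul_sum, h0, ← Complex.re_sum, Finset.sum_comm] at h2
    refine h2.trans (le_of_eq ?_)
    congr 1
    have h3 : ∀ p : Fin n × Fin n, ∑ s : ZMod (2 * n), star (v (s + (p.1 : ℕ))) *
          (a ((p.1 : ℤ) - (p.2 : ℤ)) * v (s + (p.2 : ℕ))) =
        (fun d => c d * R d) (((p.1 : ℤ) - (p.2 : ℤ) : ℤ) : ZMod (2 * n)) := by
      intro p
      have h4 : |(p.1 : ℤ) - (p.2 : ℤ)| < n := by
        rw [abs_lt]; omega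
      simp only [hc, circulantSymbol_intCast h4, R, Finset.mul_sum]
      rw [← Equiv.sum_comp (Equiv.addRight ((p.2 : ℕ) : ZMod (2 * n))) (fun s => a _ * _)]
      refine Finset.sum_congr rfl fun s _ => ?_
      simp only [Equiv.coe_addRight]
      have : s + ((p.2 : ℕ) : ZMod (2 * n)) + (((p.1 : ℤ) - (p.2 : ℤ) : ℤ) : ZMod (2 * n)) =
        s + ((p.1 : ℕ) : ZMod (2 * n)) := by push_cast; ring
      rw [this]
      ring
    simp only [h3]
    rw [← Finset.sum_fiberwise (s := Finset.univ)
      (g := fun p : Fin n × Fin n => (((p.1 : ℤ) - (p.2 : ℤ) : ℤ) : ZMod (2 * n)))]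
    refine Finset.sum_congr rfl fun d _ => ?_
    rw [diffCount, ← nsmul_eq_mul, ← Finset.sum_const]
    refine Finset.sum_congr rfl fun p hp => ?_
    rw [(Finset.mem_filter.1 hp).2]
  have herr : ‖∑ d, ((n : ℂ) - diffCount n d) * (c d * R d)‖ ≤ K * V := by
    have h1 : ∀ d, ‖((n : ℂ) - diffCount n d) * (c d * R d)‖ ≤
        |(d.valMinAbs : ℝ)| * ‖a d.valMinAbs‖ * V := by
      intro d
      have h2 : ‖(n : ℂ) - diffCount n d‖ ≤ |(d.valMinAbs : ℝ)| := by
        have h3 : (n : ℂ) - diffCount n d = ((n - diffCount n d : ℕ) : ℂ) := by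
          rw [Nat.cast_sub (diffCount_le n d)]
        rw [h3, Complex.norm_natCast, ← Int.cast_abs, ← Nat.cast_natAbs]
        have := le_diffCount_add n d
        exact_mod_cast (by omega : n - diffCount n d ≤ d.valMinAbs.natAbs)
      have h4 : ‖c d‖ ≤ ‖a d.valMinAbs‖ := by
        simp only [hc, circulantSymbol]
        split_ifs
        · exact le_rfl
        · simp
      rw [norm_mul, norm_mul, ← mul_assoc]
      gcongr
      exact hR d
    refine (norm_sum_le _ _).trans ((Finset.sum_le_sum fun d _ => h1 d).trans ?_)
    rw [← Finset.sum_mul]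
    gcongr
    have hinj : Function.Injective (fun d : ZMod (2 * n) => d.valMinAbs) :=
      fun _ _ h => ZMod.valMinAbs_inj.1 h
    have := hs.sum_le_tsum (Finset.univ.map ⟨_, hinj⟩) (fun _ _ => by positivity)
    simpa using this
  rw [hform]
  have hsplit : (n : ℂ) * ∑ d, c d * R d = ∑ d, (diffCount n d : ℂ) * (c d * R d) +
      ∑ d, ((n : ℂ) - diffCount n d) * (c d * R d) := by
    rw [Finset.mul_sum, ← Finset.sum_add_distrib]
    exact Finset.sum_congr rfl fun d _ => by ring
  have h5 := congrArg Complex.re hsplit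
  have h8 : ∀ z : ℂ, ((n : ℂ) * z).re = n * z.re := fun z => by simp
  rw [Complex.add_re, h8] at h5
  have h6 := (abs_le.1 ((Complex.abs_re_le_norm _).trans herr)).1
  have h7 : (δ * n - K) * V ≤ n * (∑ d, c d * R d).re := by nlinarith
  calc (δ - K / n) * V = (δ * n - K) * V / n := by field_simp
    _ ≤ n * (∑ d, c d * R d).re / n := by gcongr
    _ = _ := by field_simp

theorem IsCoercive.submatrix {ι κ : Type*} [Fintype ι] [Fintype κ] {δ : ℝ} {A : Matrix κ κ ℂ}
    (h : IsCoercive δ A) (e : ι ≃ κ) : IsCoercive δ (A.submatrix e e) := by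
  intro v
  have h1 := h (v ∘ e.symm)
  rw [← Equiv.sum_comp e] at h1
  simp only [Function.comp_apply, Equiv.symm_apply_apply] at h1
  refine h1.trans (le_of_eq ?_)
  rw [Matrix.submatrix_mulVec_equiv]
  simp only [dotProduct]
  rw [← Equiv.sum_comp e]
  simp

theorem IsCoercive.add_of_norm_le {ι : Type*} [Fintype ι] {δ η : ℝ} {A E : Matrix ι ι ℂ}
    (h : IsCoercive δ A)
    (hE : ∀ v : ι → ℂ, ‖star v ⬝ᵥ E *ᵥ v‖ ≤ η * ∑ i, ‖v i‖ ^ 2) :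
    IsCoercive (δ - η) (A + E) := by
  intro v
  rw [Matrix.add_mulVec, dotProduct_add, Complex.add_re]
  have h1 := h v
  have h2 := (abs_le.1 ((Complex.abs_re_le_norm _).trans (hE v))).1
  linarith

/-- The position of an index of the `2 × 2` block matrix among `0, …, 2 * n - 1`. -/
def blockPos (n : ℕ) : Fin n ⊕ Fin n → ZMod (2 * n) :=
  Sum.elim (fun k => ((k : ℕ) : ZMod (2 * n))) (fun k => ((n + k : ℕ) : ZMod (2 * n)))

theorem blockPos_bijective (n : ℕ) [NeZero (2 * n)] : Function.Bijective (blockPos n) := by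
  rw [Fintype.bijective_iff_injective_and_card]
  refine ⟨?_, by simp [ZMod.card, two_mul]⟩
  rintro (k | k) (l | l) h <;>
    simp only [blockPos, Sum.elim_inl, Sum.elim_inr, ZMod.natCast_eq_natCast_iff'] at h <;>
    rw [Nat.mod_eq_of_lt (by omega), Nat.mod_eq_of_lt (by omega)] at h
  · rw [Fin.ext h]
  · omega
  · omega
  · rw [Fin.ext (by omega : (k : ℕ) = l)]

theorem circulantEmbedding_zero_eq {a : ℤ → ℂ} (ha : ∀ j, star (a j) = a (-j)) {n : ℕ}
    [NeZero (2 * n)] :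
    circulantEmbedding a n 0 = (Matrix.of fun i j : ZMod (2 * n) =>
      circulantSymbol a n (i - j)).submatrix (blockPos n) (blockPos n) := by
  have h2n : ((2 * n : ℕ) : ZMod (2 * n)) = 0 := ZMod.natCast_self _
  have hnn : (n : ZMod (2 * n)) + n = 0 := by rw [← h2n]; push_cast; ring
  have key : ∀ {i j : ZMod (2 * n)} {t : ℤ}, |t| < n → i - j = t →
      a t = circulantSymbol a n (i - j) := fun ht h => by
    rw [h, circulantSymbol_intCast ht]
  have key0 : ∀ {i j : ZMod (2 * n)}, i - j = n →
      0 = circulantSymbol a n (i - j) := fun h => by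
    rw [h, circulantSymbol_natCast_self]
  ext (k | k) (l | l)
  · refine key (by rw [abs_lt]; omega) ?_
    simp [blockPos]
  · simp only [circulantEmbedding, Matrix.fromBlocks_apply₁₂, conjTranspose_apply,
      embeddingBlock, Matrix.of_apply, Matrix.submatrix_apply]
    split_ifs with h1 h2
    · rw [Fin.lt_def] at h1
      rw [ha]
      refine key (by rw [abs_lt]; omega) ?_
      simp only [blockPos, Sum.elim_inl, Sum.elim_inr]
      push_cast; ring
    · rw [Fin.lt_def] at h2
      rw [ha]
      refine key (by rw [abs_lt]; omega) ?_
      simp only [blockPos, Sum.elim_inl, Sum.elim_inr]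
      push_cast
      linear_combination -hnn
    · have : k = l := by
        rw [Fin.lt_def] at h1 h2; exact Fin.ext (by omega)
      subst this
      rw [star_zero]
      refine key0 ?_
      simp only [blockPos, Sum.elim_inl, Sum.elim_inr]
      push_cast
      linear_combination -hnn
  · simp only [circulantEmbedding, Matrix.fromBlocks_apply₂₁,
      embeddingBlock, Matrix.of_apply, Matrix.submatrix_apply]
    split_ifs with h1 h2
    · rw [Fin.lt_def] at h1
      refine key (by rw [abs_lt]; omega) ?_
      simp only [blockPos, Sum.elim_inl, Sum.elim_inr]
      push_cast; ring
    · rw [Fin.lt_def] at h2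
      refine key (by rw [abs_lt]; omega) ?_
      simp only [blockPos, Sum.elim_inl, Sum.elim_inr]
      push_cast
      linear_combination hnn
    · have : k = l := by
        rw [Fin.lt_def] at h1 h2; exact Fin.ext (by omega)
      subst this
      refine key0 ?_
      simp only [blockPos, Sum.elim_inl, Sum.elim_inr]
      push_cast
      ring
  · refine key (by rw [abs_lt]; omega) ?_
    simp [blockPos]

theorem circulantEmbedding_eq_add (a : ℤ → ℂ) (n : ℕ) (b₀ : ℂ) :
    circulantEmbedding a n b₀ = circulantEmbedding a n 0 +
      Matrix.fromBlocks 0 (star b₀ • 1) (b₀ • 1) 0 := by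
  have h : embeddingBlock a n b₀ = embeddingBlock a n 0 + b₀ • (1 : Matrix (Fin n) (Fin n) ℂ) := by
    ext k l
    simp only [embeddingBlock, Matrix.of_apply, Matrix.add_apply, Matrix.smul_apply,
      Matrix.one_apply]
    rcases lt_trichotomy k l with h | h | h
    · simp [h, h.ne]
    · simp [h]
    · simp [h, h.ne', h.not_gt]
  rw [circulantEmbedding, h, circulantEmbedding, Matrix.fromBlocks_add]
  simp

theorem norm_antidiagonal_form_le {n : ℕ} (b : ℂ) (v : Fin n ⊕ Fin n → ℂ) :
    ‖star v ⬝ᵥ (Matrix.fromBlocks 0 (star b • 1) (b • 1) 0) *ᵥ v‖ ≤ ‖b‖ * ∑ i, ‖v i‖ ^ 2 := by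
  have h : star v ⬝ᵥ (Matrix.fromBlocks 0 (star b • 1) (b • 1) 0) *ᵥ v =
      ∑ k : Fin n, (star (v (.inl k)) * (star b * v (.inr k)) +
        star (v (.inr k)) * (b * v (.inl k))) := by
    rw [Matrix.fromBlocks_mulVec]
    simp [dotProduct, Fintype.sum_sum_type, Finset.sum_add_distrib, Matrix.smul_mulVec]
  rw [h, Fintype.sum_sum_type, ← Finset.sum_add_distrib, Finset.mul_sum]
  refine (norm_sum_le _ _).trans (Finset.sum_le_sum fun k _ => ?_)
  refine (norm_add_le _ _).trans ?_
  simp only [norm_mul, norm_star]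
  nlinarith [mul_nonneg (norm_nonneg b) (sq_nonneg (‖v (.inl k)‖ - ‖v (.inr k)‖))]

theorem isCoercive_circulantEmbedding {a : ℤ → ℂ} (ha : ∀ j, star (a j) = a (-j)) {δ : ℝ}
    {n : ℕ} (hn : 0 < n) (hA : IsCoercive δ (toeplitzSection a n))
    (hs : Summable fun j : ℤ => |(j : ℝ)| * ‖a j‖) (b₀ : ℂ) :
    IsCoercive (δ - (∑' j : ℤ, |(j : ℝ)| * ‖a j‖) / n - ‖b₀‖) (circulantEmbedding a n b₀) := by
  have : NeZero (2 * n) := ⟨by omega⟩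
  rw [circulantEmbedding_eq_add]
  refine IsCoercive.add_of_norm_le ?_ (norm_antidiagonal_form_le b₀)
  rw [circulantEmbedding_zero_eq ha]
  exact (isCoercive_circulant hA hs).submatrix (Equiv.ofBijective _ (blockPos_bijective n))

theorem isUnit_schurMatrix {a : ℤ → ℂ} {n : ℕ} {b₀ : ℂ} (hA : IsUnit (toeplitzSection a n))
    (hC : IsUnit (circulantEmbedding a n b₀)) : IsUnit (schurMatrix a n b₀) := by
  let _ := hA.invertible
  rw [circulantEmbedding, Matrix.isUnit_fromBlocks_iff_of_invertible₁₁] at hC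
  rwa [schurMatrix, ← Matrix.invOf_eq_nonsing_inv]

theorem IsCoercive.mono {ι : Type*} [Fintype ι] {δ δ' : ℝ} {A : Matrix ι ι ℂ}
    (h : IsCoercive δ A) (hδ : δ' ≤ δ) : IsCoercive δ' A := fun v =>
  (mul_le_mul_of_nonneg_right hδ (Finset.sum_nonneg fun _ _ => sq_nonneg _)).trans (h v)

/-! ### Truncation and corner estimates -/

theorem half_le_abs_of_notMem_range_windowPos {n : ℕ} {j : ℤ}
    (hj : j ∉ Set.range (windowPos n)) : (n : ℝ) / 2 ≤ |(j : ℝ)| := by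
  have h : (n : ℤ) ≤ 2 * |j| := by
    by_contra hlt
    have h1 : |j| < |j| + 1 := lt_add_one _
    have h2 := abs_lt.1 h1
    refine hj ⟨⟨(j + ((n / 2 : ℕ) : ℤ)).toNat, by omega⟩, ?_⟩
    simp only [windowPos]
    omega
  have h' : (n : ℝ) ≤ 2 * |(j : ℝ)| := by exact_mod_cast h
  linarith

theorem abs_windowPos_le {n : ℕ} (k : Fin n) : |((windowPos n k : ℤ) : ℝ)| ≤ (n : ℝ) / 2 := by
  have h : 2 * |windowPos n k| ≤ n := by
    simp only [windowPos]
    rcases abs_cases ((k : ℤ) - ((n / 2 : ℕ) : ℤ)) with h | h <;> omega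
  have h' : 2 * |((windowPos n k : ℤ) : ℝ)| ≤ n := by exact_mod_cast h
  linarith

section Estimates

variable {x : EllTwo} {M ε : ℝ}

/-- Off the window `|j| ≥ n / 2`, so half of the decay of `x` pays for the factor in `n` and the
other half remains for summing over `j`. -/
theorem norm_sub_windowExtend_apply_le (hε : 0 < ε) (hM : 0 ≤ M)
    (hx : ∀ k : ℤ, ‖x k‖ ≤ M * Real.exp (-ε * |(k : ℝ)|)) (n : ℕ) (j : ℤ) :
    ‖(x - windowExtend n (windowRestrict n x)) j‖ ≤
      M * Real.exp (-(ε / 4) * n) * Real.exp (-(ε / 2) * |(j : ℝ)|) := by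
  rw [lp.coeFn_sub, Pi.sub_apply]
  by_cases hj : j ∈ Set.range (windowPos n)
  · obtain ⟨k, rfl⟩ := hj
    rw [windowExtend_apply_windowPos, windowRestrict, sub_self, norm_zero]
    positivity
  · rw [windowExtend_apply_of_notMem _ hj, sub_zero, mul_assoc, ← Real.exp_add]
    refine (hx j).trans ?_
    have := half_le_abs_of_notMem_range_windowPos hj
    gcongr
    nlinarith

theorem norm_sub_windowExtend_sq_le (hε : 0 < ε) (hM : 0 ≤ M)
    (hx : ∀ k : ℤ, ‖x k‖ ≤ M * Real.exp (-ε * |(k : ℝ)|)) (n : ℕ) :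
    ‖x - windowExtend n (windowRestrict n x)‖ ^ 2 ≤
      M ^ 2 * (∑' j : ℤ, Real.exp (-ε * |(j : ℝ)|)) * Real.exp (-(ε / 4) * n) := by
  set w := x - windowExtend n (windowRestrict n x)
  have h1 := hasSum_norm_sq w
  have h2 := (summable_exp_neg_abs hε).mul_left (M ^ 2 * Real.exp (-(ε / 2) * n))
  rw [← h1.tsum_eq]
  calc ∑' k, ‖w k‖ ^ 2
      ≤ ∑' j : ℤ, M ^ 2 * Real.exp (-(ε / 2) * n) * Real.exp (-ε * |(j : ℝ)|) := by
        refine h1.summable.tsum_le_tsum (fun j => ?_) h2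
        calc ‖w j‖ ^ 2 ≤ (M * Real.exp (-(ε / 4) * n) * Real.exp (-(ε / 2) * |(j : ℝ)|)) ^ 2 := by
              gcongr; exact norm_sub_windowExtend_apply_le hε hM hx n j
          _ = _ := by
              rw [mul_pow, mul_pow, ← Real.exp_nat_mul, ← Real.exp_nat_mul]
              rw [show ((2 : ℕ) : ℝ) * (-(ε / 4) * n) = -(ε / 2) * n by push_cast; ring,
                show ((2 : ℕ) : ℝ) * (-(ε / 2) * |(j : ℝ)|) = -ε * |(j : ℝ)| by push_cast; ring]
    _ = M ^ 2 * Real.exp (-(ε / 2) * n) * ∑' j : ℤ, Real.exp (-ε * |(j : ℝ)|) := tsum_mul_left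
    -- Part of the rate is given up to match the other error term.
    _ ≤ M ^ 2 * Real.exp (-(ε / 4) * n) * ∑' j : ℤ, Real.exp (-ε * |(j : ℝ)|) := by
        have : 0 ≤ ∑' j : ℤ, Real.exp (-ε * |(j : ℝ)|) := tsum_nonneg fun _ => by positivity
        gcongr
        linarith
    _ = _ := by ring

variable {a : ℤ → ℂ} {C γ : ℝ}

/-- The difference is `L` applied to the truncation error of `x`, so boundedness of `a` by `C`
suffices. -/
theorem norm_restrict_sub_toeplitzSection_mulVec_le {L : EllTwo →L[ℂ] EllTwo}
    (hL : IsToeplitz L a) (hC : 0 < C) (hγ : 0 < γ)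
    (ha : ∀ j : ℤ, ‖a j‖ ≤ C * Real.exp (-γ * |(j : ℝ)|)) (hε : 0 < ε) (hM : 0 ≤ M)
    (hx : ∀ k : ℤ, ‖x k‖ ≤ M * Real.exp (-ε * |(k : ℝ)|)) (n : ℕ) (k : Fin n) :
    ‖windowRestrict n (L x) k - (toeplitzSection a n *ᵥ windowRestrict n x) k‖ ≤
      C * M * (∑' j : ℤ, Real.exp (-(ε / 2) * |(j : ℝ)|)) * Real.exp (-(ε / 4) * n) := by
  have h0 : windowRestrict n (L x) k - (toeplitzSection a n *ᵥ windowRestrict n x) k =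
      L (x - windowExtend n (windowRestrict n x)) (windowPos n k) := by
    rw [← apply_windowExtend hL, map_sub]
    rfl
  have h1 := hasSum_apply hL (x - windowExtend n (windowRestrict n x)) (windowPos n k)
  have h2 := (summable_exp_neg_abs (half_pos hε)).mul_left (C * M * Real.exp (-(ε / 4) * n))
  rw [h0, ← h1.tsum_eq]
  refine (tsum_of_norm_bounded h2.hasSum fun l => ?_).trans (le_of_eq ?_)
  · rw [norm_mul]
    have h3 : ‖a (windowPos n k - l)‖ ≤ C := by
      refine (ha _).trans (mul_le_of_le_one_right hC.le (Real.exp_le_one_iff.2 ?_))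
      have := mul_nonneg hγ.le (abs_nonneg ((windowPos n k - l : ℤ) : ℝ))
      linarith
    calc _ ≤ C * (M * Real.exp (-(ε / 4) * n) * Real.exp (-(ε / 2) * |(l : ℝ)|)) :=
          mul_le_mul h3 (norm_sub_windowExtend_apply_le hε hM hx n l) (norm_nonneg _) hC.le
      _ = _ := by ring
  · rw [tsum_mul_left]; ring

theorem norm_embeddingBlock_apply_le
    (ha : ∀ j : ℤ, ‖a j‖ ≤ C * Real.exp (-γ * |(j : ℝ)|)) {n : ℕ} {b₀ : ℂ}
    (hb : ‖b₀‖ ≤ C * Real.exp (-γ * n)) (k l : Fin n) :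
    ‖embeddingBlock a n b₀ k l‖ ≤ C * Real.exp (-γ * (n - |(k : ℝ) - (l : ℝ)|)) := by
  have hk : (k : ℝ) < n := by exact_mod_cast k.2
  have hl : (l : ℝ) < n := by exact_mod_cast l.2
  simp only [embeddingBlock, Matrix.of_apply]
  split_ifs with h1 h2
  · have h : (k : ℝ) < l := by exact_mod_cast h1
    refine (ha _).trans (le_of_eq ?_)
    congr 3
    push_cast
    have : 0 ≤ (k : ℝ) := by positivity
    rw [abs_of_nonneg (by linarith), abs_of_neg (by linarith)]
    ring
  · have h : (l : ℝ) < k := by exact_mod_cast h2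
    refine (ha _).trans (le_of_eq ?_)
    congr 3
    push_cast
    have : 0 ≤ (l : ℝ) := by positivity
    rw [abs_of_neg (by linarith), abs_of_pos (by linarith)]
    ring
  · have : k = l := le_antisymm (not_lt.1 h2) (not_lt.1 h1)
    simpa [this] using hb

/-- An entry of `B_n` decays in `n - |l - k|` and `x` in the distance of position `l` from the
centre. These add up to at least `n / 2`, since `|l - k|` exceeds that distance by at most `n / 2`.
-/
theorem norm_embeddingBlock_conjTranspose_mulVec_le (hC : 0 < C)
    (ha : ∀ j : ℤ, ‖a j‖ ≤ C * Real.exp (-γ * |(j : ℝ)|)) (hε : 0 < ε) (hεγ : ε ≤ γ)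
    (hM : 0 ≤ M) (hx : ∀ k : ℤ, ‖x k‖ ≤ M * Real.exp (-ε * |(k : ℝ)|)) {n : ℕ} {b₀ : ℂ}
    (hb : ‖b₀‖ ≤ C * Real.exp (-γ * n)) (k : Fin n) :
    ‖((embeddingBlock a n b₀).conjTranspose *ᵥ windowRestrict n x) k‖ ≤
      C * M * n * Real.exp (-(ε / 4) * n) := by
  have h : ∀ l : Fin n, ‖(embeddingBlock a n b₀).conjTranspose k l * windowRestrict n x l‖ ≤
      C * M * Real.exp (-(ε / 4) * n) := by
    intro l
    rw [norm_mul, conjTranspose_apply, norm_star]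
    have hkl : |(l : ℝ) - (k : ℝ)| ≤
        |((windowPos n l : ℤ) : ℝ)| + |((windowPos n k : ℤ) : ℝ)| := by
      refine le_trans (le_of_eq ?_) (abs_sub _ _)
      have := windowPos_sub_windowPos l k
      rw [← Int.cast_sub, this]
      push_cast
      rfl
    have hk := abs_windowPos_le k
    have hkl' : |(l : ℝ) - (k : ℝ)| ≤ n := by
      have hk : (k : ℝ) < n := by exact_mod_cast k.2
      have hl : (l : ℝ) < n := by exact_mod_cast l.2
      have : 0 ≤ (k : ℝ) := by positivity
      have : 0 ≤ (l : ℝ) := by positivity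
      rw [abs_le]; constructor <;> linarith
    calc ‖embeddingBlock a n b₀ l k‖ * ‖windowRestrict n x l‖
        ≤ (C * Real.exp (-γ * (n - |(l : ℝ) - (k : ℝ)|))) *
          (M * Real.exp (-ε * |((windowPos n l : ℤ) : ℝ)|)) :=
          mul_le_mul (norm_embeddingBlock_apply_le ha hb l k) (hx _) (norm_nonneg _)
            (by positivity)
      _ = C * M * Real.exp (-γ * (n - |(l : ℝ) - (k : ℝ)|) +
            -ε * |((windowPos n l : ℤ) : ℝ)|) := by rw [Real.exp_add]; ring
      _ ≤ _ := by
          have h1 : ε * (n - |(l : ℝ) - (k : ℝ)|) ≤ γ * (n - |(l : ℝ) - (k : ℝ)|) :=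
            mul_le_mul_of_nonneg_right hεγ (by linarith)
          have h2 : ε * (n / 2) ≤
              ε * ((n - |(l : ℝ) - (k : ℝ)|) + |((windowPos n l : ℤ) : ℝ)|) :=
            mul_le_mul_of_nonneg_left (by linarith) hε.le
          have h3 : 0 ≤ ε * n := by positivity
          gcongr
          linarith
  refine (norm_sum_le _ _).trans ((Finset.sum_le_sum fun l _ => h l).trans (le_of_eq ?_))
  rw [Finset.sum_const, Finset.card_univ, Fintype.card_fin, nsmul_eq_mul]
  ring

end Estimates

/-! ### Comparison of the Schur complement solution with the section of `x` -/

/-- Trades the cubic factor in `n`, which arises from summing `2 * n` squared components, for part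
of the exponential rate. -/
theorem mul_sq_le_exp {q T t : ℝ} (hq : 0 < q) (hT : 0 ≤ T) (ht : 0 ≤ t) :
    t * (T + t) ^ 2 ≤ 6 / q ^ 3 * Real.exp (q * T) * Real.exp (q * t) := by
  have h1 := Real.pow_div_factorial_le_exp (x := q * (T + t)) (by positivity) 3
  rw [mul_add, Real.exp_add, ← mul_add] at h1
  have h2 : t * (T + t) ^ 2 ≤ (T + t) ^ 3 := by
    rw [pow_succ' (T + t) 2]
    gcongr
    linarith
  calc t * (T + t) ^ 2 ≤ (T + t) ^ 3 := h2
    _ = 6 / q ^ 3 * ((q * (T + t)) ^ 3 / (Nat.factorial 3 : ℕ)) := by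
      simp only [Nat.factorial]; push_cast; field_simp
    _ ≤ 6 / q ^ 3 * (Real.exp (q * T) * Real.exp (q * t)) := by gcongr
    _ = _ := by ring

/-- Block elimination: `C_{2n}` maps `(-A_n⁻¹ B_n^* z, z)` to `(0, S_n z)`, and the image of `(0,
u)` is subtracted. -/
theorem circulantEmbedding_mulVec_elim {a : ℤ → ℂ} {n : ℕ} {b₀ : ℂ}
    (hA : IsUnit (toeplitzSection a n)) (z u : Fin n → ℂ) :
    circulantEmbedding a n b₀ *ᵥ
        Sum.elim (-((toeplitzSection a n)⁻¹ *ᵥ (embeddingBlock a n b₀).conjTranspose *ᵥ z))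
          (z - u) =
      Sum.elim (-((embeddingBlock a n b₀).conjTranspose *ᵥ u))
        (schurMatrix a n b₀ *ᵥ z - toeplitzSection a n *ᵥ u) := by
  have hdet := (Matrix.isUnit_iff_isUnit_det _).1 hA
  rw [circulantEmbedding, Matrix.fromBlocks_mulVec]
  simp only [Sum.elim_comp_inl, Sum.elim_comp_inr]
  congr 1
  · rw [mulVec_neg, mulVec_mulVec, Matrix.mul_nonsing_inv _ hdet, one_mulVec, mulVec_sub]
    abel
  · rw [schurMatrix, sub_mulVec, mulVec_neg, mulVec_sub, mulVec_mulVec, mulVec_mulVec]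
    simp only [Matrix.mul_assoc]
    abel

theorem exists_forall_isCoercive_circulantEmbedding {a : ℤ → ℂ}
    (hstar : ∀ j, star (a j) = a (-j)) {δ C γ : ℝ} (hδ : 0 < δ) (hγ : 0 < γ)
    (ha : ∀ j : ℤ, ‖a j‖ ≤ C * Real.exp (-γ * |(j : ℝ)|))
    (hA : ∀ n, IsCoercive δ (toeplitzSection a n)) :
    ∃ N : ℕ, ∀ n : ℕ, N < n → ∀ b₀ : ℂ, ‖b₀‖ ≤ C * Real.exp (-γ * n) →
      IsCoercive (δ / 2) (circulantEmbedding a n b₀) := by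
  have hs : Summable fun j : ℤ => |(j : ℝ)| * ‖a j‖ := by
    refine .of_nonneg_of_le (fun _ => by positivity) (fun j => ?_)
      ((summable_abs_mul_exp_neg_abs hγ).mul_left C)
    calc |(j : ℝ)| * ‖a j‖ ≤ |(j : ℝ)| * (C * Real.exp (-γ * |(j : ℝ)|)) := by gcongr; exact ha j
      _ = _ := by ring
  set K := ∑' j : ℤ, |(j : ℝ)| * ‖a j‖ with hK
  have hK0 : 0 ≤ K := tsum_nonneg fun _ => by positivity
  -- The two terms limit the averaging loss `K / n` and the loss `‖b₀‖` to `δ / 4` each, the latter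
  -- through `t * exp (-t) ≤ 1`.
  refine ⟨⌈4 * K / δ⌉₊ + ⌈4 * C / (γ * δ)⌉₊, fun n hn b₀ hb => ?_⟩
  have hn0 : 0 < n := by omega
  have hnR : (0 : ℝ) < n := by exact_mod_cast hn0
  have hn1 : 4 * K / δ ≤ n := (Nat.le_ceil _).trans (by exact_mod_cast (by omega))
  have hn2 : 4 * C / (γ * δ) ≤ n := (Nat.le_ceil _).trans (by exact_mod_cast (by omega))
  rw [div_le_iff₀ (by positivity)] at hn1 hn2
  refine (isCoercive_circulantEmbedding hstar hn0 (hA n) hs b₀).mono ?_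
  have h1 : K / n ≤ δ / 4 := by
    rw [div_le_iff₀ hnR]; linarith
  have h2 : C * Real.exp (-γ * n) ≤ δ / 4 := by
    have h3 := Real.add_one_le_exp (γ * n)
    have h4 : Real.exp (γ * n) * Real.exp (-γ * n) = 1 := by rw [← Real.exp_add]; simp
    have h5 := Real.exp_pos (-γ * n)
    have h6 : γ * n * Real.exp (-γ * n) ≤ 1 := by nlinarith
    have h7 : C ≤ δ / 4 * (γ * n) := by linarith
    calc C * Real.exp (-γ * n) ≤ δ / 4 * (γ * n) * Real.exp (-γ * n) := by gcongr
      _ = δ / 4 * (γ * n * Real.exp (-γ * n)) := by ring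
      _ ≤ δ / 4 := mul_le_of_le_one_right (by positivity) h6
  linarith

theorem norm_windowExtend_sub_sq_le {a : ℤ → ℂ} {L : EllTwo →L[ℂ] EllTwo}
    (hL : IsToeplitz L a) {δ C γ ε M : ℝ} (hδ : 0 < δ) (hC : 0 < C) (hγ : 0 < γ)
    (ha : ∀ j : ℤ, ‖a j‖ ≤ C * Real.exp (-γ * |(j : ℝ)|)) (hε : 0 < ε) (hεγ : ε ≤ γ)
    (hM : 0 ≤ M) {x : EllTwo} (hx : ∀ k : ℤ, ‖x k‖ ≤ M * Real.exp (-ε * |(k : ℝ)|))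
    {n : ℕ} {b₀ : ℂ} (hb : ‖b₀‖ ≤ C * Real.exp (-γ * n))
    (hA : IsUnit (toeplitzSection a n)) (hco : IsCoercive δ (circulantEmbedding a n b₀))
    {z : Fin n → ℂ} (hz : schurMatrix a n b₀ *ᵥ z = windowRestrict n (L x)) :
    ‖windowExtend n (z - windowRestrict n x)‖ ^ 2 ≤
      (δ ^ 2)⁻¹ * (2 * (C * M) ^ 2) *
        (6 / (ε / 4) ^ 3 * Real.exp (ε / 4 * ∑' j : ℤ, Real.exp (-(ε / 2) * |(j : ℝ)|))) *
        Real.exp (-(ε / 4) * n) := by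
  set T := ∑' j : ℤ, Real.exp (-(ε / 2) * |(j : ℝ)|) with hT
  have hT0 : 0 ≤ T := tsum_nonneg fun _ => by positivity
  set u := windowRestrict n x with hu
  have h1 := hco.sum_norm_sq_le hδ
    (Sum.elim (-((toeplitzSection a n)⁻¹ *ᵥ (embeddingBlock a n b₀).conjTranspose *ᵥ z)) (z - u))
  rw [circulantEmbedding_mulVec_elim hA, hz] at h1
  have h2 : ∀ i, ‖Sum.elim (-((embeddingBlock a n b₀).conjTranspose *ᵥ u))
      (windowRestrict n (L x) - toeplitzSection a n *ᵥ u) i‖ ^ 2 ≤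
      (C * M * (T + n) * Real.exp (-(ε / 4) * n)) ^ 2 := by
    rintro (k | k)
    · simp only [Sum.elim_inl, Pi.neg_apply, norm_neg]
      gcongr
      refine (norm_embeddingBlock_conjTranspose_mulVec_le hC ha hε hεγ hM hx hb k).trans ?_
      gcongr
      linarith
    · simp only [Sum.elim_inr, Pi.sub_apply]
      gcongr
      refine (norm_restrict_sub_toeplitzSection_mulVec_le hL hC hγ ha hε hM hx n k).trans ?_
      gcongr
      have : (0 : ℝ) ≤ n := by positivity
      linarith
  have h3 := Finset.sum_le_sum fun i (_ : i ∈ (Finset.univ : Finset (Fin n ⊕ Fin n))) => h2 i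
  rw [Finset.sum_const, Finset.card_univ, Fintype.card_sum, Fintype.card_fin, nsmul_eq_mul] at h3
  have h4 : ‖windowExtend n (z - u)‖ ^ 2 ≤ ∑ i, ‖Sum.elim (-((toeplitzSection a n)⁻¹ *ᵥ
      (embeddingBlock a n b₀).conjTranspose *ᵥ z)) (z - u) i‖ ^ 2 := by
    rw [norm_windowExtend_sq, Fintype.sum_sum_type]
    simp only [Sum.elim_inr]
    exact le_add_of_nonneg_left (Finset.sum_nonneg fun _ _ => sq_nonneg _)
  have h5 : ((n + n : ℕ) : ℝ) * (C * M * (T + n) * Real.exp (-(ε / 4) * n)) ^ 2 =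
      2 * (C * M) ^ 2 * (n * (T + n) ^ 2) *
        (Real.exp (-(ε / 4) * n) * Real.exp (-(ε / 4) * n)) := by
    push_cast; ring
  have h6 : Real.exp (ε / 4 * n) * (Real.exp (-(ε / 4) * n) * Real.exp (-(ε / 4) * n)) =
      Real.exp (-(ε / 4) * n) := by
    rw [← Real.exp_add, ← Real.exp_add]; congr 1; ring
  have h7 := mul_sq_le_exp (by positivity : 0 < ε / 4) hT0 (Nat.cast_nonneg (α := ℝ) n)
  calc ‖windowExtend n (z - u)‖ ^ 2
      ≤ (δ ^ 2)⁻¹ * (2 * (C * M) ^ 2 * (n * (T + n) ^ 2) *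
        (Real.exp (-(ε / 4) * n) * Real.exp (-(ε / 4) * n))) := by
        rw [← h5]
        exact h4.trans (h1.trans (by gcongr))
    _ ≤ (δ ^ 2)⁻¹ * (2 * (C * M) ^ 2 *
        (6 / (ε / 4) ^ 3 * Real.exp (ε / 4 * T) * Real.exp (ε / 4 * n)) *
        (Real.exp (-(ε / 4) * n) * Real.exp (-(ε / 4) * n))) := by gcongr
    _ = (δ ^ 2)⁻¹ * (2 * (C * M) ^ 2) * (6 / (ε / 4) ^ 3 * Real.exp (ε / 4 * T)) *
        (Real.exp (ε / 4 * n) * (Real.exp (-(ε / 4) * n) * Real.exp (-(ε / 4) * n))) := by ring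
    _ = _ := by rw [h6]

theorem le_sqrt_mul_exp {r D s : ℝ} {n : ℕ}
    (h : r ^ 2 ≤ D * Real.exp (-(s / 4) * n)) : r ≤ √D * Real.exp (-(s / 8) * n) := by
  have h1 : Real.exp (-(s / 4) * n) = Real.exp (-(s / 8) * n) ^ 2 := by
    rw [← Real.exp_nat_mul]; congr 1; push_cast; ring
  refine (Real.le_sqrt_of_sq_le h).trans (le_of_eq ?_)
  rw [h1, Real.sqrt_mul' _ (sq_nonneg _), Real.sqrt_sq (Real.exp_pos _).le]

end CircEmbed

end

theorem mainTheorem5 (a : ℤ → ℂ) (L : CircEmbed.EllTwo →L[ℂ] CircEmbed.EllTwo)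
    (hToeplitz : CircEmbed.IsToeplitz L a) (hHPD : CircEmbed.IsHPD L)
    (γ : ℝ) (hγ : 0 < γ) (hDecay : CircEmbed.entry L ∈ CircEmbed.ExpDecayClass γ)
    (x y : CircEmbed.EllTwo) (hxy : L x = y)
    (hy : ∃ c' : ℝ, ∀ k : ℤ, ‖y k‖ ≤ c' * Real.exp (-γ * |(k : ℝ)|)) :
    ∃ γ₁ : ℝ, 0 < γ₁ ∧ γ₁ < γ ∧ ∃ c : ℝ, ∃ N : ℕ, ∀ n : ℕ, N < n →
      ∀ b₀ : ℂ, (b₀ = a n ∨ b₀ = 0) →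
        IsUnit (CircEmbed.toeplitzSection a n) ∧
        IsUnit (CircEmbed.circulantEmbedding a n b₀) ∧
        IsUnit (CircEmbed.schurMatrix a n b₀) ∧
        ∀ z : Fin n → ℂ,
          (CircEmbed.schurMatrix a n b₀).mulVec z = CircEmbed.windowRestrict n y →
            ‖x - CircEmbed.windowExtend n z‖ ≤ c * Real.exp (-γ₁ * (n : ℝ)) := by
  open CircEmbed in
  obtain ⟨δ, hδ, hco⟩ := hHPD.exists_coercive
  obtain ⟨C, hC, hdec⟩ := hDecay
  obtain ⟨c', hy⟩ := hy
  have ha : ∀ j : ℤ, ‖a j‖ ≤ C * Real.exp (-γ * |(j : ℝ)|) := fun j => by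
    simpa [hToeplitz j 0] using (hdec j 0).le
  obtain ⟨ε, hε, hεγ, M, hM, hx⟩ :=
    exists_exp_decay_of_apply_eq hToeplitz hδ hco hC hγ ha hxy hy
  have hA := isCoercive_toeplitzSection hToeplitz hco
  obtain ⟨N, hN⟩ := exists_forall_isCoercive_circulantEmbedding
    (conj_toeplitz hToeplitz hHPD.1) hδ hγ ha hA
  -- Both squared errors decay at rate `ε / 4`, which the square root halves. The constants belong
  -- to the tail of `x` and to `z - u`; the latter uses the coercivity constant `δ / 2`.
  refine ⟨ε / 8, by positivity, by linarith,
    √(M ^ 2 * ∑' j : ℤ, Real.exp (-ε * |(j : ℝ)|)) +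
      √(((δ / 2) ^ 2)⁻¹ * (2 * (C * M) ^ 2) * (6 / (ε / 4) ^ 3 *
        Real.exp (ε / 4 * ∑' j : ℤ, Real.exp (-(ε / 2) * |(j : ℝ)|)))), N, fun n hn b₀ hb => ?_⟩
  have hb' : ‖b₀‖ ≤ C * Real.exp (-γ * n) := by
    rcases hb with rfl | rfl
    · simpa using ha n
    · rw [norm_zero]; positivity
  have hAu := (hA n).isUnit hδ
  have hCu := (hN n hn b₀ hb').isUnit (half_pos hδ)
  refine ⟨hAu, hCu, isUnit_schurMatrix hAu hCu, fun z hz => ?_⟩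
  rw [← hxy] at hz
  have h1 := le_sqrt_mul_exp (norm_sub_windowExtend_sq_le hε hM hx n)
  have h2 := le_sqrt_mul_exp (norm_windowExtend_sub_sq_le hToeplitz (half_pos hδ) hC hγ ha hε
    hεγ.le hM hx hb' hAu (hN n hn b₀ hb') hz)
  calc ‖x - windowExtend n z‖
      = ‖(x - windowExtend n (windowRestrict n x)) -
          windowExtend n (z - windowRestrict n x)‖ := by
        rw [windowExtend_sub]; congr 1; abel
    _ ≤ _ := (norm_sub_le _ _).trans (add_le_add h1 h2)
    _ = _ := (add_mul _ _ _).symm
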